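/- For an integer $k\ge 2$ let $P_k$ be the path of length $k$ (with $k+1$ vertices). Let $\mathcal G_{P_k}$ be the class of all countable (finite or countably infinite) simple graphs that have no subgraph, induced or not, isomorphic to $P_k$. Let $\mathcal E_{P_k}$ be the class of those $G\in\mathcal G_{P_k}$ that are existentially complete: for every $H\in\mathcal G_{P_k}$ containing $G$ as an induced subgraph, every existential first-order statement in the language of graphs, with parameters from $G$, that is true in $H$ is also true in $G$. For $G\in\mathcal E_{P_k}$ and $v\in V(G)$ let $\mathrm{acl}_G(v)$ be the set of all $a\in V(G)$ for which there is an existential formula $\phi(x,v)$ in the language of graphs such that $\{a'\in V(G): G\models\phi(a',v)\}$ is finite and contains $a$. Then the maximum $$c_k(1)=\max\{|\mathrm{acl}_G(v)| : G\in\mathcal E_{P_k},\ v\in V(G)\}$$ exists (in particular, all these sets $\mathrm{acl}_G(v)$ are finite), and $$c_k(1)<k^{3k^2}.$$ -/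

import Mathlib

open FirstOrder

namespace CFree

/-- A finite graph, on a vertex set of the form `{0, …, n - 1}`. Every finite graph is isomorphic
to one of these. -/
abbrev FinGraph : Type := Σ n : ℕ, SimpleGraph (Fin n)

/-- `G` omits `C`: no subgraph of `G`, induced or not, is isomorphic to a graph in `C`. -/
def Omits {V : Type} (G : SimpleGraph V) (C : Set FinGraph) : Prop :=
  ∀ F ∈ C, ¬ F.2.IsContained G

/-- The class of countable (finite or countably infinite) graphs omitting `C`. -/
def InG (C : Set FinGraph) {V : Type} (G : SimpleGraph V) : Prop :=
  Countable V ∧ Omits G C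

/-- Truth in the graph `G` of a first-order formula in the language of graphs (adjacency and
equality), where `v` gives the values of the free variables. -/
def Holds {V : Type} (G : SimpleGraph V) {α : Type} (φ : Language.graph.Formula α)
    (v : α → V) : Prop :=
  @Language.Formula.Realize Language.graph V G.structure α φ v

/-- `G` is existentially complete in `H`, where `G` is identified with an induced subgraph of `H`
by means of `f`: each existential statement with parameters from `G` that is true in `H` is true
in `G`. -/
def ExistentiallyCompleteIn {V W : Type} (G : SimpleGraph V) (H : SimpleGraph W)
    (f : G ↪g H) : Prop :=
  ∀ φ : Language.graph.Formula V, φ.IsExistential → Holds H φ f → Holds G φ id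

/-- The class of existentially complete graphs among the countable graphs omitting `C`. -/
def InE (C : Set FinGraph) {V : Type} (G : SimpleGraph V) : Prop :=
  InG C G ∧ ∀ (W : Type) (H : SimpleGraph W) (f : G ↪g H),
    InG C H → ExistentiallyCompleteIn G H f

/-- The solution set in `G` of the formula `φ(x, A)` with parameters from `A`. The parameters are
the free variables in the left summand, and `x` is the one in the right summand. -/
def solutions {V : Type} (G : SimpleGraph V) (A : Set V)
    (φ : Language.graph.Formula (A ⊕ Unit)) : Set V :=
  {b | Holds G φ (Sum.elim (fun a : A => (a : V)) (fun _ => b))}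

/-- The algebraic closure of `A` in `G`: the vertices that belong to a finite set defined in `G`
by an existential formula with parameters from `A`. -/
def acl {V : Type} (G : SimpleGraph V) (A : Set V) : Set V :=
  {b | ∃ φ : Language.graph.Formula (A ⊕ Unit),
    φ.IsExistential ∧ (solutions G A φ).Finite ∧ b ∈ solutions G A φ}

/-- The sizes `|acl_G(A)|`, finite or infinite, where `A` is a set of `n` vertices of an
existentially complete graph `G` for `C`. -/
def aclSizes (C : Set FinGraph) (n : ℕ) : Set ℕ∞ :=
  {m | ∃ (V : Type) (G : SimpleGraph V) (A : Set V),
    InE C G ∧ A.encard = n ∧ (acl G A).encard = m}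

/-- The constraint set whose only member is the path of length `k`, which has `k + 1` vertices. -/
def pathConstraint (k : ℕ) : Set FinGraph := {⟨k + 1, SimpleGraph.pathGraph (k + 1)⟩}

/-- `c k n` is the supremum of `|acl_G(A)|` for `|A| = n` and `G` existentially complete for the
path of length `k`. -/
noncomputable def c (k n : ℕ) : ℕ∞ := sSup (aclSizes (pathConstraint k) n)

end CFree

/-! Let `G` be existentially complete without paths on k + 1 vertices, and let S be a set of at most
k vertices, in the proof the vertices of a path through v. A component K of G - S meets paths in
segments, and a segment has a type: the vertices of S next to its two ends, where there are any, and
its length. Suppose that K misses v and that each type with an end in S realized in K is realized in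
more than k components. Then a second copy of K can be attached to G without creating a forbidden
path, because each segment in the copy can be rerouted through a component that the rest of the
path, at most k vertices, does not meet. A finite existential solution set over v containing a
vertex of K would gain a solution in this extension, against existential completeness. So K contains
no vertex of acl(v) (`notMem_acl_of_frequent`).

Hence acl(v) lies in the component of v and, apart from S, only in components realizing a rare type.
There are at most (k + 1)^3 types, each rare one with at most k components. Starting from v, the
removed path is extended by a neighbour of its latest vertex in such a component. This search has
depth at most k, which yields the bound ((k + 1)^3 k + 1)^k (`encard_acl_inter_component_le`).

For the maximum to exist there must be some existentially complete graph; one is built as the union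
of a chain of finite graphs (`exists_inE`). -/

namespace CFree

/-! ### Paths as lists of vertices. -/

section PathLists

variable {V : Type} {G : SimpleGraph V}

/-- A list of vertices that forms a path of `G`. -/
def IsPathList (G : SimpleGraph V) (l : List V) : Prop :=
  l.IsChain G.Adj ∧ l.Nodup

theorem pathGraph_isContained_iff {n : ℕ} :
    (SimpleGraph.pathGraph n).IsContained G ↔ ∃ l : List V, IsPathList G l ∧ l.length = n := by
  constructor
  · rintro ⟨f⟩
    refine ⟨List.ofFn f, ⟨?_, List.nodup_ofFn.2 f.injective⟩, List.length_ofFn⟩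
    rw [List.isChain_iff_getElem]
    intro i hi
    simp only [List.getElem_ofFn]
    apply f.toHom.map_adj
    rw [SimpleGraph.pathGraph_adj]
    simp
  · rintro ⟨l, ⟨hc, hn⟩, rfl⟩
    rw [List.isChain_iff_getElem] at hc
    refine ⟨⟨⟨fun i => l[i], ?_⟩, ?_⟩⟩
    · intro a b hab
      rw [SimpleGraph.pathGraph_adj] at hab
      rcases a with ⟨a, ha⟩
      rcases b with ⟨b, hb⟩
      rcases hab with h | h
      · simp only at h
        subst h
        exact hc a hb
      · simp only at h
        subst h
        exact (hc b ha).symm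
    · exact List.nodup_iff_injective_get.1 hn

theorem omits_pathConstraint_iff {k : ℕ} :
    Omits G (pathConstraint k) ↔ ∀ l : List V, IsPathList G l → l.length ≠ k + 1 := by
  simp only [Omits, pathConstraint, Set.mem_singleton_iff, forall_eq, pathGraph_isContained_iff]
  push Not
  rfl

theorem IsPathList.map {W : Type} {H : SimpleGraph W} {l : List V} (hl : IsPathList G l)
    (f : V → W) (hf : ∀ x ∈ l, ∀ y ∈ l, G.Adj x y → H.Adj (f x) (f y))
    (hi : ∀ x ∈ l, ∀ y ∈ l, f x = f y → x = y) : IsPathList H (l.map f) := by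
  refine ⟨?_, hl.2.map_on hi⟩
  rw [List.isChain_map]
  exact List.IsChain.imp_of_mem_imp (fun x y hx hy h => hf x hx y hy h) hl.1

theorem exists_maximal_segment {α : Type} (P : α → Prop) (l : List α) (h : ∃ x ∈ l, P x) :
    ∃ l₁ q l₂, l = l₁ ++ (q ++ l₂) ∧ q ≠ [] ∧ (∀ x ∈ q, P x) ∧ (∀ x ∈ l₁, ¬ P x) ∧
      ∀ x ∈ l₂.head?, ¬ P x := by
  classical
  refine ⟨l.takeWhile (fun x => ¬ P x), (l.dropWhile (fun x => ¬ P x)).takeWhile (fun x => P x),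
    (l.dropWhile (fun x => ¬ P x)).dropWhile (fun x => P x), ?_, ?_, ?_, ?_, ?_⟩
  · rw [List.takeWhile_append_dropWhile, List.takeWhile_append_dropWhile]
  · induction l with
    | nil => simp at h
    | cons a l ih =>
      by_cases ha : P a
      · simp [ha]
      · obtain ⟨x, hx, hP⟩ := h
        rcases List.mem_cons.1 hx with rfl | hx
        · exact absurd hP ha
        · simpa [ha] using ih ⟨x, hx, hP⟩
  · intro x hx
    simpa using List.mem_takeWhile_imp hx
  · intro x hx
    simpa using List.mem_takeWhile_imp hx
  · intro x hx
    have := List.head?_dropWhile_not (fun x => decide (P x)) (l.dropWhile (fun x => ¬ P x))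
    rw [Option.mem_def.1 hx] at this
    simpa using this

end PathLists

/-! ### Duplicating part of a graph without creating long paths. -/

section Doubling

variable {V : Type}

/-- The graph obtained from `G` by adding a second copy of `E`, attached to the complement of `E`
in the same way as `E`. -/
def doubling (G : SimpleGraph V) (E : Set V) : SimpleGraph (V ⊕ E) where
  Adj
    | .inl x, .inl y => G.Adj x y
    | .inl x, .inr y => G.Adj x y ∧ x ∉ E
    | .inr x, .inl y => G.Adj x y ∧ y ∉ E
    | .inr x, .inr y => G.Adj x y
  symm := ⟨by
    rintro (x | x) (y | y) h
    · exact G.adj_symm h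
    · exact ⟨G.adj_symm h.1, h.2⟩
    · exact ⟨G.adj_symm h.1, h.2⟩
    · exact G.adj_symm h⟩
  loopless := ⟨by rintro (x | x) h <;> exact G.irrefl h⟩

variable {G : SimpleGraph V} {E : Set V}

/-- The original graph inside the doubling. -/
def doublingInl (G : SimpleGraph V) (E : Set V) : G ↪g doubling G E where
  toFun := Sum.inl
  inj' := Sum.inl_injective
  map_rel_iff' := Iff.rfl

open Classical in
/-- The embedding of a graph into its doubling that moves `E` to the second copy. -/
noncomputable def doublingInr (G : SimpleGraph V) (E : Set V) : G ↪g doubling G E where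
  toFun x := if h : x ∈ E then Sum.inr ⟨x, h⟩ else Sum.inl x
  inj' x y h := by
    dsimp only at h
    split_ifs at h <;> simp_all
  map_rel_iff' {x y} := by
    change (doubling G E).Adj (if h : x ∈ E then Sum.inr ⟨x, h⟩ else Sum.inl x)
      (if h : y ∈ E then Sum.inr ⟨y, h⟩ else Sum.inl y) ↔ _
    split_ifs with hx hy hy <;> simp [doubling, *]

theorem doublingInr_of_mem {x : V} (hx : x ∈ E) : doublingInr G E x = Sum.inr ⟨x, hx⟩ :=
  dif_pos hx

theorem doublingInr_of_notMem {x : V} (hx : x ∉ E) : doublingInr G E x = Sum.inl x :=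
  dif_neg hx

/-- `q` is a path within `C`, its first vertex is adjacent to the first of two optional end
vertices, and its last vertex to the second one. -/
def IsSegment (G : SimpleGraph V) (C : Set V) (s t : Option V) (q : List V) : Prop :=
  IsPathList G q ∧ (∀ x ∈ q, x ∈ C) ∧ (∀ a ∈ s, ∀ x ∈ q.head?, G.Adj a x) ∧
    ∀ a ∈ t, ∀ x ∈ q.getLast?, G.Adj x a

/-- The second copies in the doubling. -/
abbrev IsCopy (w : V ⊕ E) : Prop := w.isRight = true

/-- A forbidden path in the doubling is pushed back into `G` one segment at a time: the first
maximal run of copied vertices is replaced by an equally long segment of original vertices off the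
rest of the path. The induction is on the number of copied vertices. -/
theorem isPathList_doubling_length_ne {k : ℕ} (hG : ∀ l : List V, IsPathList G l → l.length ≠ k + 1)
    (hE : ∀ (s t : Option V) (q : List V), q ≠ [] → (∀ a ∈ s, a ∉ E) → (∀ a ∈ t, a ∉ E) →
      IsSegment G E s t q → (s ≠ none ∨ t ≠ none) → q.length ≤ k →
      ∀ X : List V, X.length ≤ k → ∃ q', IsSegment G Set.univ s t q' ∧ q'.length = q.length ∧
        ∀ x ∈ q', x ∉ X) :
    ∀ l : List (V ⊕ E), IsPathList (doubling G E) l → l.length ≠ k + 1 := by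
  classical
  suffices H : ∀ (n : ℕ) (l : List (V ⊕ E)), l.countP (fun w => w.isRight) = n →
      IsPathList (doubling G E) l → l.length ≠ k + 1 from fun l => H _ l rfl
  intro n
  induction n using Nat.strong_induction_on with
  | _ n ih =>
  intro l hn hl hlen
  by_cases hcopy : ∃ w ∈ l, IsCopy w
  · obtain ⟨l₁, q, l₂, rfl, hq, hqP, hl₁, hl₂⟩ := exists_maximal_segment _ l hcopy
    obtain ⟨L, rfl⟩ : ∃ L : List V, l₁ = L.map Sum.inl := by
      refine ⟨l₁.filterMap Sum.getLeft?, ?_⟩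
      clear hl hlen hn hcopy
      induction l₁ with
      | nil => rfl
      | cons a l₁ ih =>
        have := ih fun x hx => hl₁ x (List.mem_cons_of_mem _ hx)
        rcases a with a | a
        · simpa using this
        · exact absurd rfl (hl₁ (Sum.inr a) List.mem_cons_self)
    obtain ⟨Q, rfl⟩ : ∃ Q : List E, q = Q.map Sum.inr := by
      refine ⟨q.filterMap Sum.getRight?, ?_⟩
      clear hl hlen hn hcopy hq
      induction q with
      | nil => rfl
      | cons a q ih =>
        have := ih fun x hx => hqP x (List.mem_cons_of_mem _ hx)
        rcases a with a | a
        · exact absurd (hqP (Sum.inl a) List.mem_cons_self) (by simp)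
        · simpa using this
    obtain ⟨hc, hnd⟩ := hl
    obtain ⟨hc₁, hc₂, hc₁₂⟩ := List.isChain_append.1 hc
    obtain ⟨hcQ, hc₃, hcQ₂⟩ := List.isChain_append.1 hc₂
    obtain ⟨hnd₁, hnd₂, hnd₁₂⟩ := List.nodup_append.1 hnd
    obtain ⟨hndQ, hnd₃, hndQ₂⟩ := List.nodup_append.1 hnd₂
    have hQ : Q ≠ [] := by simpa using hq
    have hpQ : IsPathList G (Q.map Subtype.val) := by
      refine ⟨?_, (List.Nodup.of_map _ hndQ).map Subtype.val_injective⟩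
      rw [List.isChain_map] at hcQ ⊢
      exact hcQ
    have hleft : ∀ a ∈ L.getLast?, ∀ x ∈ Q.head?, G.Adj a x ∧ a ∉ E := by
      intro a ha x hx
      refine hc₁₂ (Sum.inl a) ?_ (Sum.inr x) ?_
      · simpa using ha
      · cases Q with
        | nil => simp at hx
        | cons y Q => simpa using hx
    have hright : ∀ a ∈ l₂.head?.bind Sum.getLeft?, ∀ x ∈ Q.getLast?, G.Adj x a ∧ a ∉ E := by
      intro a ha x hx
      refine hcQ₂ (Sum.inr x) ?_ (Sum.inl a) ?_
      · simpa using hx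
      · simpa [Option.bind_eq_some_iff, Sum.getLeft?_eq_some_iff] using ha
    -- A run without outer neighbours would be the whole path, and projecting it to `E` would give a
    -- forbidden path in `G`.
    have hsome : L.getLast? ≠ none ∨ l₂.head?.bind Sum.getLeft? ≠ none := by
      by_contra! hcon
      have hL : L = [] := List.getLast?_eq_none_iff.1 hcon.1
      have hl₂nil : l₂ = [] := by
        rcases l₂ with _ | ⟨a | a, l₂⟩
        · rfl
        · simp at hcon
        · exact absurd rfl (hl₂ (Sum.inr a) rfl)
      subst hL hl₂nil
      exact hG _ hpQ (by simpa using hlen)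
    simp only [List.length_append, List.length_map] at hlen
    have hQpos : 0 < Q.length := List.length_pos_of_ne_nil hQ
    have hlpos : 0 < L.length + l₂.length := by
      rcases hsome with h | h
      · have : L ≠ [] := fun h' => h (by simp [h'])
        have := List.length_pos_of_ne_nil this
        omega
      · have : l₂ ≠ [] := fun h' => h (by simp [h'])
        have := List.length_pos_of_ne_nil this
        omega
    obtain ⟨q', ⟨⟨hq'c, hq'n⟩, -, hq'l, hq'r⟩, hq'len, hq'X⟩ :=
      hE L.getLast? (l₂.head?.bind Sum.getLeft?) (Q.map Subtype.val) (by rwa [Ne, List.map_eq_nil_iff])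
        (fun a ha => (hleft a ha _ (List.head_mem_head? hQ)).2)
        (fun a ha => (hright a ha _ (List.getLast_mem_getLast? hQ)).2)
        ⟨hpQ, by simp +contextual, by
          intro a ha x hx
          simp only [List.head?_map, Option.mem_def, Option.map_eq_some_iff] at hx
          obtain ⟨y, hy, rfl⟩ := hx
          exact (hleft a ha y hy).1, by
          intro a ha x hx
          simp only [List.getLast?_map, Option.mem_def, Option.map_eq_some_iff] at hx
          obtain ⟨y, hy, rfl⟩ := hx
          exact (hright a ha y hy).1⟩ hsome (by rw [List.length_map]; omega)
        -- Only original vertices need to be avoided, since copied vertices left in `l₂` cannot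
        -- collide with the new segment. There are at most k of them, as `Q` is nonempty.
        (L ++ l₂.filterMap Sum.getLeft?) (by
          have := List.length_filterMap_le Sum.getLeft? l₂
          rw [List.length_append]
          omega)
    rw [List.length_map] at hq'len
    have hq'L : ∀ x ∈ q', x ∉ L := fun x hx h => hq'X x hx (List.mem_append_left _ h)
    have hq'l₂ : ∀ x ∈ q', Sum.inl x ∉ l₂ := fun x hx h =>
      hq'X x hx (List.mem_append_right _ (List.mem_filterMap.2 ⟨_, h, rfl⟩))
    refine ih _ ?_ (L.map Sum.inl ++ (q'.map Sum.inl ++ l₂)) rfl ⟨?_, ?_⟩ ?_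
    · rw [← hn]
      simp only [List.countP_append, List.countP_map]
      have h1 : List.countP ((fun w : V ⊕ E => w.isRight) ∘ Sum.inl) q' = 0 := by
        simp [List.countP_eq_zero]
      have h2 : List.countP ((fun w : V ⊕ E => w.isRight) ∘ Sum.inr) Q = Q.length := by
        simp [List.countP_eq_length]
      omega
    · have hq'nil : q' ≠ [] := List.ne_nil_of_length_pos (by omega)
      refine List.isChain_append.2 ⟨hc₁, List.isChain_append.2 ⟨?_, hc₃, ?_⟩, ?_⟩
      · rw [List.isChain_map]
        exact hq'c
      · intro x hx y hy
        simp only [List.getLast?_map, Option.mem_def, Option.map_eq_some_iff] at hx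
        obtain ⟨x, hx, rfl⟩ := hx
        rcases y with y | y
        · exact hq'r y (by rw [Option.mem_def.1 hy]; rfl) x hx
        · exact absurd rfl (hl₂ _ hy)
      · intro x hx y hy
        simp only [List.getLast?_map, Option.mem_def, Option.map_eq_some_iff] at hx
        obtain ⟨x, hx, rfl⟩ := hx
        rw [List.head?_append_of_ne_nil _ (by simpa using hq'nil)] at hy
        simp only [List.head?_map, Option.mem_def, Option.map_eq_some_iff] at hy
        obtain ⟨y, hy, rfl⟩ := hy
        exact hq'l x hx y hy
    · refine List.nodup_append.2 ⟨hnd₁, List.nodup_append.2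
        ⟨hq'n.map Sum.inl_injective, hnd₃, ?_⟩, ?_⟩
      · rintro _ hx y hy rfl
        obtain ⟨z, hz, h⟩ := List.mem_map.1 hx
        exact hq'l₂ z hz (h ▸ hy)
      · rintro _ hx y hy rfl
        rcases List.mem_append.1 hy with hy | hy
        · obtain ⟨y, hy, h⟩ := List.mem_map.1 hy
          obtain ⟨z, hz, h'⟩ := List.mem_map.1 hx
          exact hq'L y hy (Sum.inl_injective (h'.trans h.symm) ▸ hz)
        · exact hnd₁₂ _ hx _ (List.mem_append_right _ hy) rfl
    · simp only [List.length_append, List.length_map]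
      omega
  · push Not at hcopy
    refine hG (l.map (Sum.elim id Subtype.val)) (hl.map _ ?_ ?_) (by simpa using hlen)
    · rintro (x | x) hx (y | y) hy h
      · exact h
      · exact absurd rfl (hcopy _ hy)
      · exact absurd rfl (hcopy _ hx)
      · exact absurd rfl (hcopy _ hx)
    · rintro (x | x) hx (y | y) hy h
      · exact congrArg _ h
      · exact absurd rfl (hcopy _ hy)
      · exact absurd rfl (hcopy _ hx)
      · exact absurd rfl (hcopy _ hx)

end Doubling

end CFree

namespace CFree

/-! ### Existential formulas and algebraic closure under extensions. -/

section Formulas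

open Language BoundedFormula

/-- An embedding of graphs as an embedding of first-order structures. -/
def toLanguageEmbedding {V W : Type} {G : SimpleGraph V} {H : SimpleGraph W} (f : G ↪g H) :
    @Language.Embedding Language.graph V W G.structure H.structure :=
  let := G.structure
  let := H.structure
  { toFun := f
    inj' := f.injective
    map_fun' := fun f => isEmptyElim f
    map_rel' := by
      rintro n ⟨⟩ x
      exact f.map_rel_iff }

theorem Holds.map {V W : Type} {G : SimpleGraph V} {H : SimpleGraph W} (f : G ↪g H) {α : Type}
    {φ : Language.graph.Formula α} (hφ : φ.IsExistential) {v : α → V} (h : Holds G φ v) :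
    Holds H φ (f ∘ v) := by
  let := G.structure
  let := H.structure
  have := hφ.realize_embedding (toLanguageEmbedding f) h
  rwa [Subsingleton.elim (toLanguageEmbedding f ∘ default) default] at this

/-- `IsExistential` demands a block of quantifiers in front, so the conjunct θ is moved inside them,
its variables being lifted at each one. -/
theorem exists_isExistential_inf {L : Language} {α : Type} {n : ℕ} {φ : L.BoundedFormula α n}
    (hφ : φ.IsExistential) (θ : L.BoundedFormula α n) (hθ : θ.IsQF) :
    ∃ χ : L.BoundedFormula α n, χ.IsExistential ∧ ∀ (M : Type) [L.Structure M] (v : α → M)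
      (xs : Fin n → M), χ.Realize v xs ↔ φ.Realize v xs ∧ θ.Realize v xs := by
  induction hφ with
  | of_isQF h => exact ⟨_ ⊓ θ, (h.inf hθ).isExistential, fun M _ v xs => realize_inf⟩
  | @ex n φ _ ih =>
    obtain ⟨χ, hχ, h⟩ := ih (θ.liftAt 1 n) hθ.liftAt
    refine ⟨χ.ex, hχ.ex, fun M _ v xs => ?_⟩
    simp [h, realize_liftAt_one_self]

theorem IsExistential.relabel {L : Language} {α β : Type} {m n : ℕ} {φ : L.BoundedFormula α m}
    (hφ : φ.IsExistential) (g : α → β ⊕ Fin n) : (φ.relabel g).IsExistential := by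
  induction hφ with
  | of_isQF h => exact (h.relabel g).isExistential
  | ex _ ih =>
    rw [relabel_ex]
    exact ih.ex

/-- Within an existentially complete graph, an existential formula whose solution set is finite
acquires no solutions in an extension of the graph. -/
theorem solution_mem_range {C : Set FinGraph} {V W : Type} {G : SimpleGraph V} (hG : InE C G)
    {H : SimpleGraph W} (hH : InG C H) (f : G ↪g H) {A : Set V}
    {φ : Language.graph.Formula (A ⊕ Unit)} (hφ : φ.IsExistential)
    (hfin : (solutions G A φ).Finite) {w : W}
    (hw : Holds H φ (Sum.elim (fun a : A => f a) (fun _ => w))) :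
    w ∈ Set.range f := by
  by_contra hwr
  let g : A ⊕ Unit → V ⊕ Fin 1 := Sum.map Subtype.val (fun _ => 0)
  let ψ : Language.graph.BoundedFormula V 1 := BoundedFormula.relabel g φ
  -- θ says that x differs from each of the finitely many solutions in `G`. A new solution in `H`
  -- would make ∃ x (φ ∧ θ) true in `H`, hence in `G`, which is absurd.
  let θ : Language.graph.BoundedFormula V 1 :=
    (hfin.toFinset.toList.map fun c => ∼(Term.bdEqual (Term.var (Sum.inr (0 : Fin 1)))
      (Term.var (Sum.inl c)))).foldr (· ⊓ ·) ⊤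
  have hθ : θ.IsQF := by
    suffices ∀ l : List V, ((l.map fun c => (∼(Term.bdEqual (Term.var (Sum.inr (0 : Fin 1)))
        (Term.var (Sum.inl c))) : Language.graph.BoundedFormula V 1)).foldr (· ⊓ ·) ⊤).IsQF from
      this _
    intro l
    induction l with
    | nil => exact IsQF.top
    | cons c l ih => exact ((IsAtomic.equal _ _).isQF.not).inf ih
  obtain ⟨χ, hχ, hχr⟩ := exists_isExistential_inf (IsExistential.relabel hφ g : ψ.IsExistential) θ hθ
  have hreal : ∀ (M : Type) [Language.graph.Structure M] (v : V → M),
      Formula.Realize (χ.ex : Language.graph.Formula V) v ↔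
      ∃ x : M, φ.Realize (Sum.elim (fun a : A => v a) (fun _ => x)) ∧
        ∀ c ∈ solutions G A φ, x ≠ v c := by
    intro M _ v
    unfold Formula.Realize
    rw [realize_ex]
    refine exists_congr fun x => ?_
    rw [hχr]
    refine and_congr ?_ ?_
    · rw [realize_relabel]
      refine Eq.to_iff ?_
      congr 1
      · ext i
        rcases i with i | i <;> simp [g]; rfl
      · exact Subsingleton.elim _ _
    · rw [realize_foldr_inf]
      simp [Fin.snoc]
  have hholds : Holds H (χ.ex : Language.graph.Formula V) f := by
    let := H.structure
    refine (hreal W f).2 ⟨w, hw, ?_⟩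
    rintro c - rfl
    exact hwr ⟨c, rfl⟩
  have hholds' := hG.2 W H f hH _ hχ.ex hholds
  let := G.structure
  obtain ⟨x, hx, hxc⟩ := (hreal V id).1 hholds'
  exact hxc x hx rfl

/-- The embedding that moves `E` to its copy fixes `A`, so the copy of `b` would be a new solution.
-/
theorem notMem_acl_of_doubling {C : Set FinGraph} {V : Type} {G : SimpleGraph V} (hG : InE C G)
    {E : Set V} (hE : Omits (doubling G E) C) {A : Set V} (hA : Disjoint A E) {b : V}
    (hb : b ∈ E) : b ∉ acl G A := by
  rintro ⟨φ, hφ, hfin, hbs⟩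
  have := hG.1.1
  have h := Holds.map (doublingInr G E) hφ hbs
  have h' : doublingInr G E ∘ Sum.elim (fun a : A => (a : V)) (fun _ : Unit => b) =
      Sum.elim (fun a : A => doublingInl G E a) (fun _ => Sum.inr ⟨b, hb⟩) := by
    ext i
    rcases i with a | i
    · exact doublingInr_of_notMem (Set.disjoint_left.1 hA a.2)
    · exact doublingInr_of_mem hb
  rw [h'] at h
  obtain ⟨x, hx⟩ := solution_mem_range hG ⟨inferInstance, hE⟩ (doublingInl G E) hφ hfin h
  cases hx

end Formulas

end CFree

namespace CFree

/-! ### Bounding the closure by a search through components. -/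

section Components

variable {V : Type}

/-- The graph `G` with all edges that meet `S` removed. -/
def avoid (G : SimpleGraph V) (S : List V) : SimpleGraph V where
  Adj x y := G.Adj x y ∧ x ∉ S ∧ y ∉ S
  symm := ⟨fun _ _ h => ⟨h.1.symm, h.2.2, h.2.1⟩⟩
  loopless := ⟨fun _ h => G.irrefl h.1⟩

variable {G : SimpleGraph V}

theorem notMem_of_mem_component {S : List V} {b : V} (hb : b ∉ S) {x : V}
    (hx : x ∈ ((avoid G S).connectedComponentMk b).supp) : x ∉ S := by
  obtain ⟨w⟩ := SimpleGraph.ConnectedComponent.exact hx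
  cases w with
  | nil => exact hb
  | cons h _ => exact h.2.1

theorem mem_of_adj_component {S : List V} {b : V} (hb : b ∉ S) {x y : V}
    (hx : x ∈ ((avoid G S).connectedComponentMk b).supp)
    (hy : y ∉ ((avoid G S).connectedComponentMk b).supp) (h : G.Adj x y) : y ∈ S := by
  by_contra hyS
  have hxy : (avoid G S).Adj y x := ⟨h.symm, hyS, notMem_of_mem_component hb hx⟩
  exact hy ((SimpleGraph.ConnectedComponent.sound hxy.reachable).trans hx)

/-- `C` contains a path of the type `τ`, which consists of the optional neighbours of the two ends
of the path and of its number of vertices. -/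
def Realizes (G : SimpleGraph V) (C : Set V) (τ : Option V × Option V × ℕ) : Prop :=
  ∃ q, IsSegment G C τ.1 τ.2.1 q ∧ q.length = τ.2.2

/-- The components of `G` without `S` that realize `τ`. -/
def realizers (G : SimpleGraph V) (S : List V) (τ : Option V × Option V × ℕ) :
    Set (avoid G S).ConnectedComponent :=
  {K | Realizes G K.supp τ}

/-- Components are disjoint, so at most k vertices meet at most k of them. -/
theorem exists_segment_avoiding {S : List V} {τ : Option V × Option V × ℕ} {k : ℕ}
    (hτ : ¬ (realizers G S τ).encard ≤ k) {X : List V} (hX : X.length ≤ k) :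
    ∃ q, IsSegment G Set.univ τ.1 τ.2.1 q ∧ q.length = τ.2.2 ∧ ∀ x ∈ q, x ∉ X := by
  classical
  let F : Finset (avoid G S).ConnectedComponent :=
    (X.map (avoid G S).connectedComponentMk).toFinset
  have hF : (F : Set (avoid G S).ConnectedComponent).encard ≤ k := by
    rw [Set.encard_coe_eq_coe_finsetCard]
    exact_mod_cast (List.toFinset_card_le _).trans (by simpa using hX)
  obtain ⟨K, ⟨q, hq, hql⟩, hKF⟩ : ∃ K ∈ realizers G S τ, K ∉ (F : Set _) := by
    by_contra! h
    exact hτ ((Set.encard_le_encard h).trans hF)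
  refine ⟨q, ⟨hq.1, fun _ _ => trivial, hq.2.2⟩, hql, fun x hx hxX => hKF ?_⟩
  have : (avoid G S).connectedComponentMk x = K := hq.2.1 x hx
  rw [← this]
  exact List.mem_toFinset.2 (List.mem_map_of_mem hxX)

/-- The segment types with ends in `S` and at most `k` vertices. -/
def segmentTypes [DecidableEq V] (S : List V) (k : ℕ) : Finset (Option V × Option V × ℕ) :=
  Finset.insertNone S.toFinset ×ˢ Finset.insertNone S.toFinset ×ˢ Finset.range (k + 1)

theorem card_segmentTypes_le [DecidableEq V] {S : List V} {k : ℕ} (hS : S.length ≤ k) :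
    (segmentTypes S k).card ≤ (k + 1) ^ 3 := by
  have : S.toFinset.card + 1 ≤ k + 1 := by
    have := List.toFinset_card_le S
    omega
  simp only [segmentTypes, Finset.card_product, Finset.card_insertNone, Finset.card_range]
  calc _ ≤ (k + 1) * ((k + 1) * (k + 1)) := by gcongr
    _ = _ := by ring

theorem notMem_acl_of_frequent [DecidableEq V] {k : ℕ} (hG : InE (pathConstraint k) G)
    {S : List V} {v b : V} (hb : b ∉ S)
    (hv : (avoid G S).connectedComponentMk b ≠ (avoid G S).connectedComponentMk v)
    (hfreq : ∀ τ ∈ segmentTypes S k, (τ.1 ≠ none ∨ τ.2.1 ≠ none) →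
      (avoid G S).connectedComponentMk b ∈ realizers G S τ →
      ¬ (realizers G S τ).encard ≤ k) :
    b ∉ acl G {v} := by
  refine notMem_acl_of_doubling hG (E := ((avoid G S).connectedComponentMk b).supp) ?_ ?_ rfl
  · rw [omits_pathConstraint_iff]
    refine isPathList_doubling_length_ne (omits_pathConstraint_iff.1 hG.1.2) ?_
    intro s t q hq hs ht hseg hst hqk X hX
    refine exists_segment_avoiding (S := S) (τ := (s, t, q.length))
      (hfreq _ ?_ hst ⟨q, hseg, rfl⟩) hX
    simp only [segmentTypes, Finset.mem_product, Finset.mem_insertNone, List.mem_toFinset,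
      Finset.mem_range]
    refine ⟨fun a ha => ?_, fun a ha => ?_, by omega⟩
    · have hh := List.head_mem_head? hq
      exact mem_of_adj_component hb (hseg.2.1 _ (List.head_mem hq)) (hs a ha)
        (hseg.2.2.1 a ha _ hh).symm
    · have hh := List.getLast_mem_getLast? hq
      exact mem_of_adj_component hb (hseg.2.1 _ (List.getLast_mem hq)) (ht a ha)
        (hseg.2.2.2 a ha _ hh)
  · rw [Set.disjoint_singleton_left]
    exact fun h => hv (SimpleGraph.ConnectedComponent.mem_supp_iff _ _ |>.1 h).symm

theorem encard_biUnion_le {ι α : Type} {s : Set ι} {f : ι → Set α} {m n : ℕ}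
    (hs : s.encard ≤ m) (hf : ∀ i ∈ s, (f i).encard ≤ n) :
    (⋃ i ∈ s, f i).encard ≤ (m * n : ℕ) := by
  classical
  have hfin : s.Finite := Set.finite_of_encard_le_coe hs
  lift s to Finset ι using hfin
  rw [Set.encard_coe_eq_coe_finsetCard] at hs
  have hsm : s.card ≤ m := by exact_mod_cast hs
  suffices (⋃ i ∈ (s : Set ι), f i).encard ≤ (s.card * n : ℕ) from
    this.trans (by exact_mod_cast Nat.mul_le_mul_right n hsm)
  clear hs hsm
  induction s using Finset.induction_on with
  | empty => simp
  | insert a s ha ih =>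
    rw [Finset.coe_insert, Set.biUnion_insert, Finset.card_insert_of_notMem ha]
    refine (Set.encard_union_le _ _).trans ?_
    refine (add_le_add (hf a (by simp)) (ih fun i hi => hf i (by simp_all))).trans ?_
    rw [add_mul, one_mul, add_comm]
    push_cast
    exact le_rfl

/-- A vertex of the component of `x` other than `x` lies in the component of a neighbour of `x`
once `x` is removed. -/
theorem exists_adj_of_mem_component {S : List V} {x y : V} (hx : x ∉ S) (hxy : y ≠ x)
    (hy : y ∈ ((avoid G S).connectedComponentMk x).supp) :
    ∃ z, G.Adj z x ∧ z ∉ x :: S ∧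
      (avoid G (x :: S)).connectedComponentMk y = (avoid G (x :: S)).connectedComponentMk z := by
  obtain ⟨w⟩ := SimpleGraph.ConnectedComponent.exact hy
  clear hy
  induction w with
  | nil => exact absurd rfl hxy
  | @cons y y' x h w ih =>
    have hyS : y ∉ x :: S := by simp [hxy, h.2.1]
    by_cases hy' : y' = x
    · subst hy'
      exact ⟨y, h.1, hyS, rfl⟩
    · obtain ⟨z, hzx, hz, hyz⟩ := ih hx hy'
      have hyy' : (avoid G (x :: S)).Adj y y' := ⟨h.1, hyS, by simp [hy', h.2.2]⟩
      exact ⟨z, hzx, hz, (SimpleGraph.ConnectedComponent.sound hyy'.reachable).trans hyz⟩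

theorem encard_acl_inter_component_le {k : ℕ} (hG : InE (pathConstraint k) G) {v : V} (n : ℕ) :
    ∀ (S : List V) (x : V), IsPathList G (x :: S) → S.length + n = k → v ∈ x :: S →
      (acl G {v} ∩ ((avoid G S).connectedComponentMk x).supp).encard ≤
        (((k + 1) ^ 3 * k + 1) ^ n : ℕ) := by
  classical
  induction n with
  | zero =>
    intro S x hS hk
    -- Here `x :: S` has k + 1 vertices, so it is a forbidden path.
    exact absurd (by simpa using hk) (omits_pathConstraint_iff.1 hG.1.2 _ hS)
  | succ n ih =>
    intro S x hS hk hv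
    set N := ((k + 1) ^ 3 * k + 1) ^ n
    let rare : Set (Option V × Option V × ℕ) :=
      {τ | τ ∈ segmentTypes (x :: S) k ∧ (realizers G (x :: S) τ).encard ≤ k}
    -- Components next to `x`: only for these does the path `x :: S` extend by a vertex of the
    -- component, as the induction requires.
    let near : Set (avoid G (x :: S)).ConnectedComponent :=
      {K | ∃ z, G.Adj z x ∧ z ∉ x :: S ∧ K = (avoid G (x :: S)).connectedComponentMk z}
    have hcover : acl G {v} ∩ ((avoid G S).connectedComponentMk x).supp ⊆
        {x} ∪ ⋃ τ ∈ rare, ⋃ K ∈ realizers G (x :: S) τ ∩ near, acl G {v} ∩ K.supp := by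
      rintro y ⟨hya, hy⟩
      by_cases hyx : y = x
      · exact Or.inl hyx
      right
      obtain ⟨z, hzx, hz, hyz⟩ := exists_adj_of_mem_component (List.nodup_cons.1 hS.2).1 hyx hy
      have hyS : y ∉ x :: S := notMem_of_mem_component hz hyz
      by_contra hcon
      refine notMem_acl_of_frequent hG hyS ?_ ?_ hya
      -- The vertex `v` is on the removed path, so the component of `y` misses it.
      · intro h
        exact notMem_of_mem_component hyS h.symm hv
      · intro τ hτ _ hreal hk
        refine hcon ?_
        simp only [Set.mem_iUnion]
        exact ⟨τ, ⟨hτ, hk⟩, _, ⟨hreal, z, hzx, hz, hyz⟩, hya, rfl⟩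
    have hrare : rare.encard ≤ ((k + 1) ^ 3 : ℕ) := by
      refine (Set.encard_le_encard (t := (segmentTypes (x :: S) k : Set _)) fun τ h => h.1).trans ?_
      rw [Set.encard_coe_eq_coe_finsetCard]
      exact_mod_cast card_segmentTypes_le (by simp only [List.length_cons]; omega)
    have hbound : (⋃ τ ∈ rare, ⋃ K ∈ realizers G (x :: S) τ ∩ near,
        acl G {v} ∩ K.supp).encard ≤ ((k + 1) ^ 3 * (k * N) : ℕ) := by
      refine encard_biUnion_le hrare fun τ hτ => encard_biUnion_le
        ((Set.encard_le_encard Set.inter_subset_left).trans hτ.2) ?_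
      rintro K ⟨-, z, hzx, hz, rfl⟩
      exact ih (x :: S) z ⟨hS.1.cons_cons hzx, hS.2.cons hz⟩
        (by simp only [List.length_cons]; omega) (List.mem_cons_of_mem _ hv)
    refine (Set.encard_le_encard hcover).trans ((Set.encard_union_le _ _).trans ?_)
    rw [Set.encard_singleton]
    refine (add_le_add le_rfl hbound).trans ?_
    -- The vertex `x` itself costs 1 ≤ `N`, whence the `+ 1` in the base of the power.
    have hN : 1 ≤ N := Nat.one_le_pow _ _ (by omega)
    have : 1 + (k + 1) ^ 3 * (k * N) ≤ ((k + 1) ^ 3 * k + 1) ^ (n + 1) := by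
      rw [pow_succ]
      change _ ≤ N * _
      nlinarith
    exact_mod_cast this

/-- In an existentially complete graph without paths of length `k`, the algebraic closure of
a vertex is bounded in terms of `k`. -/
theorem encard_acl_singleton_le {k : ℕ} (hG : InE (pathConstraint k) G) (v : V) :
    (acl G {v}).encard ≤ (((k + 1) ^ 3 * k + 1) ^ k : ℕ) := by
  classical
  suffices hsub : acl G {v} ⊆ ((avoid G []).connectedComponentMk v).supp by
    have := encard_acl_inter_component_le hG (v := v) k [] v ⟨by simp, by simp⟩ (by simp) (by simp)
    rwa [Set.inter_eq_left.2 hsub] at this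
  intro b hb
  by_contra h
  refine notMem_acl_of_frequent hG (S := []) (by simp) h ?_ hb
  -- With nothing removed, no segment type has an end, so the frequency condition is vacuous.
  rintro ⟨s, t, n⟩ hτ hst
  simp only [segmentTypes, List.toFinset_nil, Finset.mem_product, Finset.mem_insertNone,
    Finset.notMem_empty, Option.mem_def] at hτ
  rcases s with _ | s <;> rcases t with _ | t <;> simp_all

end Components

end CFree

namespace CFree

/-! ### Construction of an existentially complete graph. -/

section Existence

open Language BoundedFormula

/-- The truth of an existential formula depends on finitely many vertices only. -/
theorem exists_finite_witnesses {W : Type} {H : SimpleGraph W} {α : Type} {n : ℕ}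
    {φ : Language.graph.BoundedFormula α n} (hφ : φ.IsExistential) (v : α → W) (xs : Fin n → W)
    (h : @BoundedFormula.Realize _ _ H.structure _ _ φ v xs) :
    ∃ T : Set W, T.Finite ∧ ∀ (U : Type) (K : SimpleGraph U) (g : K ↪g H), T ⊆ Set.range g →
      ∀ (v' : α → U) (xs' : Fin n → U), g ∘ v' = v → g ∘ xs' = xs →
        @BoundedFormula.Realize _ _ K.structure _ _ φ v' xs' := by
  let := H.structure
  induction hφ with
  | of_isQF hQF =>
    refine ⟨∅, Set.finite_empty, ?_⟩
    rintro U K g - v' xs' rfl rfl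
    let := K.structure
    exact (hQF.realize_embedding (toLanguageEmbedding g)).1 h
  | ex _ ih =>
    obtain ⟨a, ha⟩ := realize_ex.1 h
    obtain ⟨T, hT, hTK⟩ := ih _ ha
    refine ⟨insert a T, hT.insert a, ?_⟩
    intro U K g hg v' xs' hv hxs
    obtain ⟨a', rfl⟩ := hg (Set.mem_insert a T)
    let := K.structure
    refine realize_ex.2 ⟨a', hTK U K g ((Set.subset_insert _ _).trans hg) _ _ hv ?_⟩
    rw [Fin.comp_snoc, hxs]

/-- The truth of a formula depends on the values of finitely many variables only. -/
theorem exists_holds_congr (φ : Language.graph.Formula ℕ) :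
    ∃ N : ℕ, ∀ (W : Type) (H : SimpleGraph W) (v v' : ℕ → W), (∀ i < N, v i = v' i) →
      Holds H φ v → Holds H φ v' := by
  refine ⟨φ.freeVarFinset.sup id + 1, fun W H v v' hv h => ?_⟩
  let := H.structure
  have h' := (realize_restrictFreeVar' (subset_refl _)).2 h
  refine (realize_restrictFreeVar' (subset_refl _)).1 ?_
  convert h' using 1
  ext i
  exact (hv i (Nat.lt_succ_of_le (Finset.le_sup (f := id) i.2))).symm

/-- Adding isolated vertices creates no paths. -/
theorem Omits.map {k : ℕ} (hk : 1 ≤ k) {V W : Type} {G : SimpleGraph V}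
    (hG : Omits G (pathConstraint k)) (e : V ↪ W) : Omits (G.map e) (pathConstraint k) := by
  intro F hF
  rw [pathConstraint, Set.mem_singleton_iff] at hF
  subst hF
  rintro ⟨f⟩
  -- Since k ≥ 1, each vertex of the path has a neighbour, so none can land on an added isolated
  -- vertex.
  have hnbr : ∀ i : Fin (k + 1), ∃ j, (SimpleGraph.pathGraph (k + 1)).Adj i j := by
    intro i
    by_cases hi : i.val = 0
    · exact ⟨⟨1, by omega⟩, by simp [SimpleGraph.pathGraph_adj, hi]⟩
    · exact ⟨⟨i - 1, by omega⟩, by rw [SimpleGraph.pathGraph_adj]; right; simp; omega⟩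
  have hrange : ∀ i, ∃ x, e x = f i := by
    intro i
    obtain ⟨j, hj⟩ := hnbr i
    obtain ⟨x, y, -, hx, -⟩ := (SimpleGraph.map_adj _ _ _ _).1 (f.toHom.map_adj hj)
    exact ⟨x, hx⟩
  choose p hp using hrange
  refine hG _ rfl ⟨⟨⟨p, fun {i j} hij => ?_⟩, fun i j hij => f.injective ?_⟩⟩
  · have := f.toHom.map_adj hij
    simp only [SimpleGraph.Copy.toHom_apply] at this
    rwa [← hp i, ← hp j, SimpleGraph.map_adj_apply] at this
  · change f i = f j
    rw [← hp i, ← hp j]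
    exact congrArg e hij

/-- `F` is the subgraph of `F'` induced by an initial segment of the vertices. -/
def Extends (F F' : FinGraph) : Prop :=
  ∃ h : F.1 ≤ F'.1, ∀ i j, F'.2.Adj (Fin.castLE h i) (Fin.castLE h j) ↔ F.2.Adj i j

theorem Extends.refl (F : FinGraph) : Extends F F := ⟨le_rfl, fun _ _ => Iff.rfl⟩

theorem Extends.trans {F₁ F₂ F₃ : FinGraph} (h₁ : Extends F₁ F₂) (h₂ : Extends F₂ F₃) :
    Extends F₁ F₃ := by
  obtain ⟨h, ha⟩ := h₁
  obtain ⟨h', hb⟩ := h₂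
  exact ⟨h.trans h', fun i j => (hb _ _).trans (ha _ _)⟩

theorem exists_extends_of_embedding (F : FinGraph) {W : Type} {H : SimpleGraph W} (f : F.2 ↪g H)
    {T : Set W} (hT : T.Finite) :
    ∃ (F' : FinGraph) (h : F.1 ≤ F'.1) (g : F'.2 ↪g H), Extends F F' ∧ T ⊆ Set.range g ∧
      ∀ i, g (Fin.castLE h i) = f i := by
  classical
  obtain ⟨n, F⟩ := F
  have hfin : (T \ Set.range f).Finite := hT.subset Set.sdiff_subset
  let D := hfin.toFinset
  let e := D.equivFin.symm
  have he : Function.Injective (Fin.append f (fun i => (e i : W))) := by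
    rw [Fin.append_injective_iff]
    refine ⟨f.injective, Subtype.val_injective.comp e.injective, fun i j h => ?_⟩
    have := (e j).2
    simp only [D, Set.Finite.mem_toFinset] at this
    exact this.2 ⟨i, h⟩
  let g : H.comap (Fin.append f (fun i => (e i : W))) ↪g H := ⟨⟨_, he⟩, Iff.rfl⟩
  have hg : ∀ i, g (Fin.castLE (Nat.le_add_right n D.card) i) = f i :=
    fun i => Fin.append_left f (fun i => (e i : W)) i
  refine ⟨⟨n + D.card, H.comap (Fin.append f (fun i => (e i : W)))⟩, Nat.le_add_right _ _, g,
    ⟨Nat.le_add_right _ _, fun i j => ?_⟩, fun t ht => ?_, hg⟩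
  · rw [← g.map_adj_iff, hg, hg, f.map_adj_iff]
  · by_cases htf : t ∈ Set.range f
    · obtain ⟨i, rfl⟩ := htf
      exact ⟨_, hg i⟩
    · refine ⟨Fin.natAdd n (e.symm ⟨t, hfin.mem_toFinset.2 ⟨ht, htf⟩⟩), ?_⟩
      change Fin.append f (fun i => (e i : W)) _ = t
      rw [Fin.append_right, Equiv.apply_symm_apply]

/-- The first `n` numbers are sent to themselves, and the others to `0`. -/
def clip {n : ℕ} (hn : 0 < n) (i : ℕ) : Fin n := if h : i < n then ⟨i, h⟩ else ⟨0, hn⟩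

/-- Every existential formula that can be made true in some extension of a finite graph
can be made true in a finite one. -/
theorem exists_extends_holds {k : ℕ} (hk : 1 ≤ k) (F : FinGraph) (hF : Omits F.2 (pathConstraint k))
    (hn : 0 < F.1) (φ : Language.graph.Formula ℕ) (hφ : φ.IsExistential) :
    ∃ F' : FinGraph, Extends F F' ∧ F.1 < F'.1 ∧ Omits F'.2 (pathConstraint k) ∧
      ∀ (h : F.1 ≤ F'.1) (W : Type) (H : SimpleGraph W) (f : F.2 ↪g H),
        Omits H (pathConstraint k) → Holds H φ (f ∘ clip hn) →
          Holds F'.2 φ (Fin.castLE h ∘ clip hn) := by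
  obtain ⟨F₁, hFF₁, hF₁, hφ₁⟩ : ∃ F₁ : FinGraph, Extends F F₁ ∧ Omits F₁.2 (pathConstraint k) ∧
      ∀ (h : F.1 ≤ F₁.1) (W : Type) (H : SimpleGraph W) (f : F.2 ↪g H),
        Omits H (pathConstraint k) → Holds H φ (f ∘ clip hn) →
          Holds F₁.2 φ (Fin.castLE h ∘ clip hn) := by
    by_cases hex : ∃ (W : Type) (H : SimpleGraph W) (f : F.2 ↪g H),
        Omits H (pathConstraint k) ∧ Holds H φ (f ∘ clip hn)
    · obtain ⟨W, H, f, hH, hHφ⟩ := hex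
      obtain ⟨T, hT, hTK⟩ := exists_finite_witnesses hφ _ _ hHφ
      obtain ⟨F₁, h₁, g, hext, hTg, hg⟩ := exists_extends_of_embedding F f hT
      refine ⟨F₁, hext, fun P hP hcon => hH P hP (hcon.trans g.isContained), ?_⟩
      intro h _ _ _ _ _
      refine hTK _ F₁.2 g hTg _ _ ?_ (Subsingleton.elim _ _)
      ext i
      exact hg _
    · exact ⟨F, Extends.refl F, hF, fun h W H f hH hHφ => absurd ⟨W, H, f, hH, hHφ⟩ hex⟩
  obtain ⟨h₁, hadj⟩ := hFF₁
  -- The extra isolated vertex makes the chain grow strictly, so that its union has vertex set ℕ.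
  refine ⟨⟨F₁.1 + 1, F₁.2.map Fin.castSuccEmb⟩, ⟨h₁.trans (Nat.le_succ _), fun i j => ?_⟩,
    Nat.lt_succ_of_le h₁, hF₁.map hk _, fun h W H f hH hHφ => ?_⟩
  · exact (SimpleGraph.map_adj_apply (f := Fin.castSuccEmb)).trans (hadj i j)
  · exact Holds.map (SimpleGraph.Embedding.map Fin.castSuccEmb F₁.2) hφ (hφ₁ h₁ W H f hH hHφ)

/-- A chain of finite graphs without paths of length `k`. -/
structure GrowingChain (k : ℕ) where
  /-- The members of the chain. -/
  graph : ℕ → FinGraph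
  omits : ∀ m, Omits (graph m).2 (pathConstraint k)
  extends_succ : ∀ m, Extends (graph m) (graph (m + 1))
  lt_card : ∀ m, m < (graph m).1

namespace GrowingChain

variable {k : ℕ} (c : GrowingChain k)

theorem extends_of_le {m m' : ℕ} (h : m ≤ m') : Extends (c.graph m) (c.graph m') := by
  induction m', h using Nat.le_induction with
  | base => exact Extends.refl _
  | succ m' _ ih => exact ih.trans (c.extends_succ m')

/-- The union of a chain. -/
def union : SimpleGraph ℕ where
  Adj i j := ∃ m, ∃ (hi : i < (c.graph m).1) (hj : j < (c.graph m).1),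
    (c.graph m).2.Adj ⟨i, hi⟩ ⟨j, hj⟩
  symm := ⟨fun _ _ ⟨m, hi, hj, h⟩ => ⟨m, hj, hi, h.symm⟩⟩
  loopless := ⟨fun _ ⟨_, _, _, h⟩ => SimpleGraph.irrefl _ h⟩

theorem union_adj_iff (m : ℕ) (i j : Fin (c.graph m).1) :
    c.union.Adj i j ↔ (c.graph m).2.Adj i j := by
  refine ⟨?_, fun h => ⟨m, i.2, j.2, h⟩⟩
  rintro ⟨m', hi, hj, h⟩
  rcases le_total m m' with hm | hm
  · obtain ⟨_, hadj⟩ := c.extends_of_le hm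
    exact (hadj i j).1 h
  · obtain ⟨_, hadj⟩ := c.extends_of_le hm
    exact (hadj ⟨i, hi⟩ ⟨j, hj⟩).2 h

/-- The members of the chain are induced subgraphs of its union. -/
def toUnion (m : ℕ) : (c.graph m).2 ↪g c.union where
  toFun := Fin.val
  inj' := Fin.val_injective
  map_rel_iff' := c.union_adj_iff m _ _

theorem omits_union : Omits c.union (pathConstraint k) := by
  intro P hP ⟨f⟩
  let m := Finset.univ.sup f
  have hm : ∀ i, f i < (c.graph m).1 := fun i =>
    (Finset.le_sup (f := f) (Finset.mem_univ i)).trans_lt (c.lt_card m)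
  refine c.omits m P hP ⟨⟨⟨fun i => ⟨f i, hm i⟩, fun {i j} hij => ?_⟩, fun i j hij => ?_⟩⟩
  · exact (c.union_adj_iff m _ _).1 (f.toHom.map_adj hij)
  · exact f.injective (Fin.mk.inj_iff.1 hij)

end GrowingChain

/-- Vertices serve as variables, so countably many formulas cover all parameters. Stage `m` treats
the formula with index `m.unpair.1`; each formula thus recurs, also at stages that already contain
all its parameters. -/
theorem exists_inE {k : ℕ} (hk : 1 ≤ k) : ∃ G : SimpleGraph ℕ, InE (pathConstraint k) G := by
  classical
  obtain ⟨φ, hφ⟩ := exists_surjective_nat (Language.graph.Formula ℕ)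
  let Stage := {F : FinGraph // Omits F.2 (pathConstraint k) ∧ 0 < F.1}
  have hstep : ∀ (m : ℕ) (F : Stage), ∃ F' : Stage, Extends F.1 F'.1 ∧ F.1.1 < F'.1.1 ∧
      ((φ m.unpair.1).IsExistential → ∀ (h : F.1.1 ≤ F'.1.1) (W : Type) (H : SimpleGraph W)
        (f : F.1.2 ↪g H), Omits H (pathConstraint k) → Holds H (φ m.unpair.1) (f ∘ clip F.2.2) →
          Holds F'.1.2 (φ m.unpair.1) (Fin.castLE h ∘ clip F.2.2)) := by
    rintro m ⟨F, hF, hn⟩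
    by_cases hex : (φ m.unpair.1).IsExistential
    · obtain ⟨F', h, hlt, hF', hφ'⟩ := exists_extends_holds hk F hF hn _ hex
      exact ⟨⟨F', hF', by omega⟩, h, hlt, fun _ => hφ'⟩
    · obtain ⟨F', h, hlt, hF', -⟩ := exists_extends_holds hk F hF hn ⊥ IsQF.falsum.isExistential
      exact ⟨⟨F', hF', by omega⟩, h, hlt, fun h => absurd h hex⟩
  choose next hext hlt hnext using hstep
  have hpoint : Omits (⊥ : SimpleGraph (Fin 1)) (pathConstraint k) := by
    rw [omits_pathConstraint_iff]
    intro l hl hlen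
    have := hl.2.length_le_card
    simp only [Fintype.card_fin] at this
    omega
  let stage : ℕ → Stage := Nat.rec ⟨⟨1, ⊥⟩, hpoint, Nat.one_pos⟩ next
  let c : GrowingChain k :=
    { graph := fun m => (stage m).1
      omits := fun m => (stage m).2.1
      extends_succ := fun m => hext m (stage m)
      lt_card := by
        intro m
        induction m with
        | zero => exact Nat.one_pos
        | succ m ih => exact (Nat.succ_le_of_lt ih).trans_lt (hlt m (stage m)) }
  refine ⟨c.union, ⟨inferInstance, c.omits_union⟩, fun W H f hH ψ hψ hHψ => ?_⟩
  obtain ⟨a, rfl⟩ := hφ ψ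
  obtain ⟨N, hN⟩ := exists_holds_congr (φ a)
  -- Since `N` ≤ `m`, and stage `m` has more than `m` vertices, `clip` fixes all variables that
  -- matter to the formula.
  let m := Nat.pair a N
  have hm : φ m.unpair.1 = φ a := by simp [m]
  have hNm : N < (stage m).1.1 := (Nat.right_le_pair a N).trans_lt (c.lt_card m)
  have hclip : ∀ i < N, (clip (stage m).2.2 i : ℕ) = i := by
    intro i hi
    rw [clip, dif_pos (hi.trans hNm)]
  have key := hnext m (stage m) (hm ▸ hψ) (hlt m (stage m)).le W H (f.comp (c.toUnion m)) hH.2 (by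
    rw [hm]
    refine hN W H _ _ (fun i hi => ?_) hHψ
    exact congrArg f (hclip i hi).symm)
  rw [hm] at key
  refine hN ℕ c.union _ _ (fun i hi => ?_) (Holds.map (c.toUnion (m + 1)) hψ key)
  exact hclip i hi

end Existence

end CFree

/-! ### The numerical bound and the conclusion. -/

theorem CFree.acl_bound_lt {k : ℕ} (hk : 2 ≤ k) : ((k + 1) ^ 3 * k + 1) ^ k < k ^ (3 * k ^ 2) := by
  -- For k = 2 this reads 55 < 64; the remaining comparison 6k ≤ 3k² also uses k ≥ 2.
  have h6 : (k + 1) ^ 3 * k + 1 < k ^ 6 := by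
    obtain ⟨j, rfl⟩ := Nat.exists_eq_add_of_le hk
    ring_nf
    nlinarith [pow_pos (Nat.succ_pos j) 2, pow_nonneg (Nat.zero_le j) 3, pow_nonneg (Nat.zero_le j) 4, pow_nonneg (Nat.zero_le j) 5, pow_nonneg (Nat.zero_le j) 6]
  calc ((k + 1) ^ 3 * k + 1) ^ k < (k ^ 6) ^ k := Nat.pow_lt_pow_left h6 (by omega)
    _ = k ^ (6 * k) := (pow_mul _ _ _).symm
    _ ≤ k ^ (3 * k ^ 2) := Nat.pow_le_pow_right (by omega) (by nlinarith)

theorem proposition9 (k : ℕ) (hk : 2 ≤ k) :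
    IsGreatest (CFree.aclSizes (CFree.pathConstraint k) 1) (CFree.c k 1) ∧
      CFree.c k 1 < (k : ℕ∞) ^ (3 * k ^ 2) := by
  have hbound : ∀ m ∈ CFree.aclSizes (CFree.pathConstraint k) 1,
      m ≤ (((k + 1) ^ 3 * k + 1) ^ k : ℕ) := by
    rintro m ⟨V, G, A, hG, hA, rfl⟩
    obtain ⟨v, rfl⟩ := Set.encard_eq_one.1 (hA.trans Nat.cast_one)
    exact CFree.encard_acl_singleton_le hG v
  have hne : (CFree.aclSizes (CFree.pathConstraint k) 1).Nonempty := by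
    obtain ⟨G, hG⟩ := CFree.exists_inE (k := k) (by omega)
    exact ⟨_, ℕ, G, {0}, hG, by simp, rfl⟩
  have hc : CFree.c k 1 ≤ (((k + 1) ^ 3 * k + 1) ^ k : ℕ) := sSup_le hbound
  have := hne.to_subtype
  -- A nonempty set in `ℕ∞` with finite supremum attains it.
  refine ⟨⟨ENat.sSup_mem_of_nonempty_of_lt_top (hc.trans_lt (ENat.natCast_lt_top _)),
    fun m hm => le_sSup hm⟩, hc.trans_lt ?_⟩
  exact_mod_cast CFree.acl_bound_lt hk
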